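/- Let $d\ge 3$ and write points of $\mathbb R^d=\mathbb R\times\mathbb R^{d-1}$ as $(x,\mathbf y)$ and frequencies as $(\xi,\boldsymbol\eta)$; let $\mathcal F$ denote the Fourier transform in the space variables $(x,\mathbf y)$, with phase $e^{-i(x\xi+\mathbf y\cdot\boldsymbol\eta)}$. For $p\in\mathbb R^d$ and $r>0$ let $B_r(p)\subset\mathbb R^d$ be the open Euclidean ball with center $p$ and radius $r$, and put $P_{B_r(p)}f=\mathcal F^{-1}\mathbf 1_{B_r(p)}\mathcal F f$. For $t\in\mathbb R$ let $U(t)=e^{-t\partial_x\Delta}$ be the propagator of the linear Zakharov–Kuznetsov equation $\partial_t u+\partial_x\Delta u=0$, i.e. the Fourier multiplier with symbol $e^{it\xi(\xi^2+|\boldsymbol\eta|^2)}$, and let $|\partial_x|^s$ be the Fourier multiplier with symbol $|\xi|^s$. There is a constant $C>0$, depending only on $d$, such that for all $0\le s\le \tfrac14$, all $p\in\mathbb R^d$, all $r>0$ and all $f\in L^2(\mathbb R^d;\mathbb C)$, $$\big\||\partial_x|^sU(t)P_{B_r(p)}f\big\|_{L^4_{t,x,\mathbf y}(\mathbb R\times\mathbb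 R^d)}\le C\,r^{\frac{d-3}{4}+s}\,\|P_{B_r(p)}f\|_{L^2_{x,\mathbf y}(\mathbb R^d)} .$$ -/

import Mathlib

open MeasureTheory
open scoped FourierTransform

noncomputable section

namespace ZK

/-- The space (and frequency space) `ℝ^d`. Coordinate `0` is the distinguished variable `x`
(resp. `ξ`), the other `d - 1` coordinates are the transverse variables `𝐲` (resp. `𝛈`). -/
abbrev Space (d : ℕ) := EuclideanSpace ℝ (Fin d)

/-- Complex-valued square integrable functions on `ℝ^d`, modulo equality almost everywhere. -/
abbrev L2 (d : ℕ) := Lp ℂ 2 (volume : Measure (Space d))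

/-- `f ∈ L²` is in the domain of the Fourier multiplier with symbol `m`: the product of the symbol
with the Fourier transform of `f` is square integrable.

Symbols are functions of the angular frequency `ξ`, dual to `x` through `exp(-i x·ξ)`. Mathlib's
`𝓕` uses `exp(-2πi x·k)`, so the symbol is evaluated at `ξ = 2πk`. -/
def InMultiplierDomain {d : ℕ} (m : Space d → ℂ) (f : L2 d) : Prop :=
  MemLp (fun k : Space d => m ((2 * Real.pi) • k) * (𝓕 f : L2 d) k) 2 volume

/-- The Fourier multiplier with symbol `m` (in angular frequency), `f ↦ 𝓕⁻¹ (m · 𝓕 f)`, on its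
natural domain in `L²`. -/
def fourierMultiplier {d : ℕ} (m : Space d → ℂ) (f : L2 d) (h : InMultiplierDomain m f) : L2 d :=
  𝓕⁻ (h.toLp (fun k : Space d => m ((2 * Real.pi) • k) * (𝓕 f : L2 d) k) : L2 d)

theorem fourier_fourierMultiplier {d : ℕ} (m : Space d → ℂ) (f : L2 d)
    (h : InMultiplierDomain m f) :
    ((𝓕 (fourierMultiplier m f h) : L2 d) : Space d → ℂ) =ᵐ[volume]
      fun k => m ((2 * Real.pi) • k) * (𝓕 f : L2 d) k := by
  rw [fourierMultiplier, FourierTransform.fourier_fourierInv_eq]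
  exact h.coeFn_toLp

/-- Multipliers with bounded measurable symbols are defined on all of `L²`. -/
theorem inMultiplierDomain_of_bounded {d : ℕ} {m : Space d → ℂ} (hm : Measurable m) {c : ℝ}
    (hc : ∀ ξ, ‖m ξ‖ ≤ c) (f : L2 d) : InMultiplierDomain m f := by
  refine (Lp.memLp (𝓕 f : L2 d)).of_le_mul (c := c) ?_ ?_
  · exact ((hm.comp (measurable_const_smul _)).aestronglyMeasurable).mul
      (Lp.memLp (𝓕 f : L2 d)).aestronglyMeasurable
  · refine Filter.Eventually.of_forall fun k => ?_
    rw [norm_mul]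
    exact mul_le_mul_of_nonneg_right (hc _) (norm_nonneg _)

/-- The symbol `1_{B_r(p)}`. -/
def ballSymbol {d : ℕ} (p : Space d) (r : ℝ) : Space d → ℂ :=
  (Metric.ball p r).indicator fun _ => 1

theorem measurable_ballSymbol {d : ℕ} (p : Space d) (r : ℝ) : Measurable (ballSymbol p r) :=
  measurable_const.indicator measurableSet_ball

theorem norm_ballSymbol_le {d : ℕ} (p : Space d) (r : ℝ) (ξ : Space d) :
    ‖ballSymbol p r ξ‖ ≤ 1 := by
  unfold ballSymbol
  by_cases h : ξ ∈ Metric.ball p r <;> simp [h]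

/-- The frequency projection `P_{B_r(p)} f = 𝓕⁻¹ (1_{B_r(p)} 𝓕 f)`. -/
def freqProj {d : ℕ} (p : Space d) (r : ℝ) (f : L2 d) : L2 d :=
  fourierMultiplier (ballSymbol p r) f
    (inMultiplierDomain_of_bounded (measurable_ballSymbol p r) (norm_ballSymbol_le p r) f)

/-- The symbol of `exp(-t ∂ₓ Δ)`: `∂ₓ` has symbol `i ξ₀` and the Laplacian of `ℝ^d` has symbol
`-|ξ|²`, so this is `exp(i t ξ₀ |ξ|²)`. -/
def propagatorSymbol {d : ℕ} [NeZero d] (t : ℝ) (ξ : Space d) : ℂ :=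
  Complex.exp (-(t : ℂ) * (Complex.I * ((ξ 0 : ℝ) : ℂ)) * (-((‖ξ‖ ^ 2 : ℝ) : ℂ)))

theorem measurable_propagatorSymbol {d : ℕ} [NeZero d] (t : ℝ) :
    Measurable (propagatorSymbol (d := d) t) := by
  unfold propagatorSymbol
  exact Continuous.measurable (by fun_prop)

theorem norm_propagatorSymbol_le {d : ℕ} [NeZero d] (t : ℝ) (ξ : Space d) :
    ‖propagatorSymbol t ξ‖ ≤ 1 := by
  have h : -(t : ℂ) * (Complex.I * ((ξ 0 : ℝ) : ℂ)) * (-((‖ξ‖ ^ 2 : ℝ) : ℂ)) =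
      ((t * ξ 0 * ‖ξ‖ ^ 2 : ℝ) : ℂ) * Complex.I := by
    push_cast
    ring
  rw [propagatorSymbol, h, Complex.norm_exp_ofReal_mul_I]

/-- The propagator `U(t) = exp(-t ∂ₓ Δ)` of the linear Zakharov–Kuznetsov equation
`∂ₜ u + ∂ₓ Δ u = 0`. -/
def propagator {d : ℕ} [NeZero d] (t : ℝ) (f : L2 d) : L2 d :=
  fourierMultiplier (propagatorSymbol t) f
    (inMultiplierDomain_of_bounded (measurable_propagatorSymbol t) (norm_propagatorSymbol_le t) f)

/-- The symbol `|ξ₀|^s` of `|∂ₓ|^s`. -/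
def absDxSymbol {d : ℕ} [NeZero d] (s : ℝ) (ξ : Space d) : ℂ :=
  ((|ξ 0| ^ s : ℝ) : ℂ)

/-- The Fourier multiplier `|∂ₓ|^s` in the first variable, on its natural domain in `L²`. -/
def absDx {d : ℕ} [NeZero d] (s : ℝ) (f : L2 d)
    (h : InMultiplierDomain (absDxSymbol s) f) : L2 d :=
  fourierMultiplier (absDxSymbol s) f h

/-- For `s ≥ 0` the function `U(t) P_{B_r(p)} f` is in the domain of `|∂ₓ|^s`. -/
theorem inMultiplierDomain_absDx {d : ℕ} [NeZero d] {s : ℝ} (hs : 0 ≤ s) (t : ℝ) (p : Space d)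
    (r : ℝ) (f : L2 d) :
    InMultiplierDomain (absDxSymbol s) (propagator t (freqProj p r f)) := by
  refine (Lp.memLp (𝓕 f : L2 d)).of_le_mul (c := (‖p‖ + |r|) ^ s) ?_ ?_
  · refine AEStronglyMeasurable.mul ?_ (Lp.memLp (𝓕 _ : L2 d)).aestronglyMeasurable
    refine Measurable.aestronglyMeasurable ?_
    unfold absDxSymbol
    fun_prop
  · filter_upwards [fourier_fourierMultiplier (propagatorSymbol t) (freqProj p r f)
        (inMultiplierDomain_of_bounded (measurable_propagatorSymbol t)
          (norm_propagatorSymbol_le t) _),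
      fourier_fourierMultiplier (ballSymbol p r) f
        (inMultiplierDomain_of_bounded (measurable_ballSymbol p r)
          (norm_ballSymbol_le p r) f)] with k h1 h2
    change _ = _ at h1
    rw [show propagator t (freqProj p r f) = fourierMultiplier (propagatorSymbol t)
      (freqProj p r f) _ from rfl, h1, show freqProj p r f = fourierMultiplier (ballSymbol p r) f _
      from rfl, h2]
    set ξ : Space d := (2 * Real.pi) • k
    have hU := norm_propagatorSymbol_le t ξ
    rw [← mul_assoc, ← mul_assoc, norm_mul, norm_mul, norm_mul]
    refine mul_le_mul_of_nonneg_right ?_ (norm_nonneg _)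
    by_cases hξ : ξ ∈ Metric.ball p r
    · have h0 : |ξ 0| ≤ ‖p‖ + |r| := by
        have ha : |ξ 0| ≤ ‖ξ‖ := by simpa using PiLp.norm_apply_le ξ 0
        have hb : ‖ξ - p‖ < r := by simpa [dist_eq_norm] using hξ
        have hc : ‖ξ‖ ≤ ‖ξ - p‖ + ‖p‖ := by simpa using norm_add_le (ξ - p) p
        have hd := le_abs_self r
        linarith
      have hA : ‖absDxSymbol s ξ‖ ≤ (‖p‖ + |r|) ^ s := by
        rw [absDxSymbol, Complex.norm_real, Real.norm_of_nonneg (by positivity)]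
        exact Real.rpow_le_rpow (abs_nonneg _) h0 hs
      have hB := norm_ballSymbol_le p r ξ
      calc _ ≤ (‖p‖ + |r|) ^ s * 1 * 1 := by gcongr
        _ = _ := by ring
    · have : ballSymbol p r ξ = 0 := by simp [ballSymbol, hξ]
      rw [this]
      simp only [norm_zero, mul_zero]
      positivity

end ZK

end

/-! The proof is bilinear. With g the Fourier transform of the localized datum, u = |∂ₓ|^s U(t) P f
is an oscillatory integral of g, and ‖u‖₄² = ‖u²‖₂, where u² is an oscillatory integral over pairs
(k₁, k₂) with phase map (ψ(k₁) + ψ(k₂), k₁ + k₂). By duality (`lintegral_enorm_oscillatory_sq_le`)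
it suffices that the push-forward of the squared weight |k₁₀|^{2s} |k₂₀|^{2s} dk₁ dk₂ under this map
has density O(r^{d-3+4s}).

Fix ζ = k₁ + k₂. In two transverse coordinates of k₁ the summed phase is a constant plus 4π²ζ₀ times
a squared distance (`exists_zkPhase_add_eq`); in the plane this gives density at most 1/(4π|ζ₀|).
The other d - 3 transverse coordinates contribute O(r^{d-3}). If the first frequencies have equal
sign, both are at most |ζ₀| in modulus, so the squared weight is at most |ζ₀|^{4s} and the first
coordinate ranges over length at most 2 min(r, |ζ₀|). Since 4s ≤ 1, min(r, |ζ₀|) |ζ₀|^{4s-1} ≤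
r^{4s} (`min_mul_rpow_le`), uniformly in ζ. Splitting g by the sign of k₀ costs a factor 2. -/

/-! ### The Fourier transform on L¹ ∩ L² -/

section FourierL2

variable {E : Type*} [NormedAddCommGroup E] [InnerProductSpace ℝ E] [FiniteDimensional ℝ E]
  [MeasurableSpace E] [BorelSpace E]

/-- The Fourier transform on `L²` of an integrable function is given by the integral. -/
theorem fourier_toLp_ae_eq {f : E → ℂ} (h1 : Integrable f) (h2 : MemLp f 2) :
    ((𝓕 (h2.toLp f) : Lp ℂ 2 (volume : Measure E)) : E → ℂ) =ᵐ[volume] 𝓕 f := by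
  have hc : Continuous (𝓕 f : E → ℂ) :=
    VectorFourier.fourierIntegral_continuous Real.continuous_fourierChar
      (L := innerₗ E) continuous_inner h1
  -- Both sides are tested against smooth compactly supported functions: the distributional
  -- transform moves 𝓕 onto the test function, and the multiplication formula moves it back to `f`.
  refine ae_eq_of_integral_contDiff_smul_eq
    ((Lp.memLp _).locallyIntegrable (by norm_num)) hc.locallyIntegrable ?_
  intro g hg hgs
  have hgs' : HasCompactSupport (fun x => (g x : ℂ)) := hgs.comp_left Complex.ofReal_zero
  let φ : SchwartzMap E ℂ := hgs'.toSchwartzMap (Complex.ofRealCLM.contDiff.comp hg)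
  have hφ : ∀ x, φ x = (g x : ℂ) := fun x => rfl
  have h := congrArg (fun T => T φ) (Lp.fourier_toTemperedDistribution_eq (h2.toLp f))
  simp only [TemperedDistribution.fourier_apply, Lp.toTemperedDistribution_apply] at h
  have hl : ∫ x, (𝓕 φ) x • (h2.toLp f : E → ℂ) x = ∫ x, φ x • (𝓕 f) x := by
    rw [integral_congr_ae (g := fun x => (𝓕 φ) x • f x)
      (by filter_upwards [h2.coeFn_toLp] with x hx; rw [hx])]
    rw [SchwartzMap.fourier_coe]
    have := VectorFourier.integral_fourierIntegral_smul_eq_flip (L := innerₗ E)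
      Real.continuous_fourierChar continuous_inner (φ.integrable (μ := volume)) h1
    rw [flip_innerₗ] at this
    exact this
  rw [hl] at h
  simp only [hφ] at h
  simpa using h.symm

/-- The inverse Fourier transform on `L²` of an integrable function is given by the integral. -/
theorem fourierInv_toLp_ae_eq {f : E → ℂ} (h1 : Integrable f) (h2 : MemLp f 2) :
    ((𝓕⁻ (h2.toLp f) : Lp ℂ 2 (volume : Measure E)) : E → ℂ) =ᵐ[volume] 𝓕⁻ f := by
  have hneg : Continuous fun p : E × E => (-innerₗ E) p.1 p.2 := by
    change Continuous fun p : E × E => -inner ℝ p.1 p.2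
    exact continuous_inner.neg
  have hc : Continuous (𝓕⁻ f : E → ℂ) :=
    VectorFourier.fourierIntegral_continuous Real.continuous_fourierChar
      (L := -innerₗ E) hneg h1
  refine ae_eq_of_integral_contDiff_smul_eq
    ((Lp.memLp _).locallyIntegrable (by norm_num)) hc.locallyIntegrable ?_
  intro g hg hgs
  have hgs' : HasCompactSupport (fun x => (g x : ℂ)) := hgs.comp_left Complex.ofReal_zero
  let φ : SchwartzMap E ℂ := hgs'.toSchwartzMap (Complex.ofRealCLM.contDiff.comp hg)
  have hφ : ∀ x, φ x = (g x : ℂ) := fun x => rfl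
  have h := congrArg (fun T => T φ) (Lp.fourierInv_toTemperedDistribution_eq (h2.toLp f))
  simp only [TemperedDistribution.fourierInv_apply, Lp.toTemperedDistribution_apply] at h
  have hl : ∫ x, (𝓕⁻ φ) x • (h2.toLp f : E → ℂ) x = ∫ x, φ x • (𝓕⁻ f) x := by
    rw [integral_congr_ae (g := fun x => (𝓕⁻ φ) x • f x)
      (by filter_upwards [h2.coeFn_toLp] with x hx; rw [hx])]
    rw [SchwartzMap.fourierInv_coe]
    have := VectorFourier.integral_fourierIntegral_smul_eq_flip (L := -innerₗ E)
      Real.continuous_fourierChar hneg (φ.integrable (μ := volume)) h1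
    rw [show (-innerₗ E).flip = -innerₗ E by ext; simp [real_inner_comm]] at this
    exact this
  rw [hl] at h
  simp only [hφ] at h
  simpa using h.symm

/-- Plancherel's theorem for integrable, square integrable functions. -/
theorem lintegral_enorm_fourier_sq {f : E → ℂ} (h1 : Integrable f) (h2 : MemLp f 2) :
    ∫⁻ x, ‖𝓕 f x‖ₑ ^ 2 = ∫⁻ x, ‖f x‖ₑ ^ 2 := by
  have h : eLpNorm (𝓕 f) 2 volume = eLpNorm f 2 volume := by
    rw [← eLpNorm_congr_ae (fourier_toLp_ae_eq h1 h2), ← eLpNorm_congr_ae h2.coeFn_toLp,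
      ← Lp.enorm_def, ← Lp.enorm_def]
    simp only [← ofReal_norm, Lp.norm_fourier_eq]
  have h' := congrArg (· ^ (2 : ℝ)) h
  have key : ∀ g : E → ℂ, eLpNorm g 2 volume ^ (2 : ℝ) = ∫⁻ x, ‖g x‖ₑ ^ 2 := fun g => by
    have := eLpNorm_nnreal_pow_eq_lintegral (f := g) (p := 2) (μ := volume) (by norm_num)
    simpa using this
  simpa only [key] using h'

end FourierL2

/-! ### L² bounds for oscillatory integrals by duality -/

section Duality

variable {V : Type*} [NormedAddCommGroup V] [InnerProductSpace ℝ V] [FiniteDimensional ℝ V]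
  [MeasurableSpace V] [BorelSpace V]

open scoped ENNReal ComplexConjugate in
/-- An oscillatory integral with phase `Ψ` is square integrable if the weighted push-forward of the
measure under `Ψ` has a bounded density. -/
theorem lintegral_enorm_oscillatory_sq_le {X : Type*} [MeasurableSpace X] {μ : Measure X}
    [SFinite μ] {Ψ : X → V} (hΨ : Measurable Ψ) {G : X → ℂ} (hG : Integrable G μ)
    {ρ F : X → ℝ≥0∞} (hρ : Measurable ρ) (hF : Measurable F)
    (hle : ∀ x, ‖G x‖ₑ ≤ F x * ρ x) {K : ℝ≥0∞}
    (hK : ∀ h : V → ℝ≥0∞, Measurable h → ∫⁻ x, ρ x ^ 2 * h (Ψ x) ∂μ ≤ K * ∫⁻ v, h v) :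
    ∫⁻ v, ‖∫ x, 𝐞 (inner ℝ (Ψ x) v) • G x ∂μ‖ₑ ^ 2 ≤ K * ∫⁻ x, F x ^ 2 ∂μ := by
  set w : V → ℂ := fun v => ∫ x, 𝐞 (inner ℝ (Ψ x) v) • G x ∂μ with hw
  have hmeas : ∀ v, AEStronglyMeasurable (fun x => 𝐞 (inner ℝ (Ψ x) v) • G x) μ := fun v =>
    (Real.continuous_fourierChar.comp_aestronglyMeasurable
      (hΨ.inner measurable_const).aestronglyMeasurable).smul hG.1
  have hwc : Continuous w := by
    refine continuous_of_dominated hmeas (bound := fun x => ‖G x‖) (fun v => ?_) hG.norm ?_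
    · exact Filter.Eventually.of_forall fun x => by simp
    · refine Filter.Eventually.of_forall fun x => ?_
      have := Real.continuous_fourierChar
      fun_prop
  have hwb : ∀ v, ‖w v‖ ≤ ∫ x, ‖G x‖ ∂μ := fun v => by
    refine (norm_integral_le_integral_norm _).trans_eq ?_
    simp
  -- Truncating to a ball puts `h` in L¹ ∩ L² and makes `a` finite, so that `a` can be cancelled
  -- from a² ≤ K ‖F‖₂² a at the end.
  have main : ∀ N : ℝ, ∫⁻ v in Metric.closedBall 0 N, ‖w v‖ₑ ^ 2 ≤ K * ∫⁻ x, F x ^ 2 ∂μ := by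
    intro N
    set B : Set V := Metric.closedBall 0 N
    have hB : MeasurableSet B := Metric.isClosed_closedBall.measurableSet
    have hBf : volume B < ∞ := (isCompact_closedBall _ _).measure_lt_top
    set h : V → ℂ := B.indicator w with hh
    have h1 : Integrable h :=
      (hwc.locallyIntegrable.integrableOn_isCompact (isCompact_closedBall _ _)).integrable_indicator
        hB
    have h2 : MemLp h 2 := by
      rw [memLp_indicator_iff_restrict hB]
      have : IsFiniteMeasure (volume.restrict B) := ⟨by simpa using hBf⟩
      exact MemLp.of_bound hwc.aestronglyMeasurable _ (Filter.Eventually.of_forall hwb)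
    set a : ℝ≥0∞ := ∫⁻ v, ‖h v‖ₑ ^ 2 with ha
    have haB : ∫⁻ v in B, ‖w v‖ₑ ^ 2 = a := by
      rw [ha, ← lintegral_indicator hB]
      refine lintegral_congr fun v => ?_
      by_cases hv : v ∈ B <;> simp [hh, hv]
    have hafin : a ≠ ∞ := by
      have := h2.2
      have e := eLpNorm_nnreal_pow_eq_lintegral (f := h) (p := 2) (μ := volume) (by norm_num)
      have e' : eLpNorm h 2 volume ^ (2 : ℝ) = a := by simpa using e
      rw [← e']
      exact ENNReal.rpow_ne_top_of_nonneg (by norm_num) this.ne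
    have e1 : a = ‖∫ v, conj (h v) * w v‖ₑ := by
      have : ∀ v, conj (h v) * w v = ((‖h v‖ ^ 2 : ℝ) : ℂ) := fun v => by
        by_cases hv : v ∈ B
        · simp [hh, hv, Complex.conj_mul']
        · simp [hh, hv]
      simp_rw [this]
      rw [integral_complex_ofReal, ← ofReal_norm, Complex.norm_real,
        Real.norm_of_nonneg (integral_nonneg fun v => by positivity),
        ofReal_integral_eq_lintegral_ofReal ?_ (Filter.Eventually.of_forall fun v => by positivity)]
      · refine lintegral_congr fun v => ?_
        rw [ENNReal.ofReal_pow (norm_nonneg _), ofReal_norm]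
      · exact (memLp_two_iff_integrable_sq_norm h2.1).1 h2
    have e2 : ∫ v, conj (h v) * w v = ∫ x, G x * conj (𝓕 h (Ψ x)) ∂μ := by
      have hint : Integrable (Function.uncurry fun (v : V) (x : X) =>
          conj (h v) * (𝐞 (inner ℝ (Ψ x) v) • G x)) ((volume : Measure V).prod μ) := by
        have hp : Integrable (fun z : V × X => conj (h z.1) * G z.2)
            ((volume : Measure V).prod μ) :=
          Integrable.mul_prod (f := fun v => conj (h v))
            (Complex.conjLIE.toContinuousLinearEquiv.toContinuousLinearMap.integrable_comp h1) hG
        have hq : AEStronglyMeasurable (fun z : V × X => 𝐞 (inner ℝ (Ψ z.2) z.1))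
            ((volume : Measure V).prod μ) :=
          Real.continuous_fourierChar.comp_aestronglyMeasurable
            ((hΨ.comp measurable_snd).inner measurable_fst).aestronglyMeasurable
        refine hp.mono ((hq.smul hp.1).congr (Filter.Eventually.of_forall fun z => ?_))
          (Filter.Eventually.of_forall fun z => ?_)
        · simp only [Function.uncurry, Circle.smul_def, smul_eq_mul, Pi.smul_apply']
          ring
        · simp [Function.uncurry]
      calc ∫ v, conj (h v) * w v = ∫ v : V, ∫ x, conj (h v) * (𝐞 (inner ℝ (Ψ x) v) • G x) ∂μ := by
            simp_rw [hw, integral_const_mul]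
        _ = ∫ x, (∫ v : V, conj (h v) * (𝐞 (inner ℝ (Ψ x) v) • G x)) ∂μ := integral_integral_swap hint
        _ = _ := by
            refine integral_congr_ae (Filter.Eventually.of_forall fun x => ?_)
            simp only
            rw [Real.fourier_eq, ← integral_conj, ← integral_const_mul]
            refine integral_congr_ae (Filter.Eventually.of_forall fun v => ?_)
            simp only [Circle.smul_def, smul_eq_mul, map_mul]
            rw [← Circle.coe_inv_eq_conj, AddChar.map_neg_eq_inv, inv_inv, real_inner_comm]
            ring
    have hFh : Measurable (𝓕 h : V → ℂ) :=
      (VectorFourier.fourierIntegral_continuous Real.continuous_fourierChar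
        (L := innerₗ V) continuous_inner h1).measurable
    have e3 : a ≤ (∫⁻ x, F x ^ 2 ∂μ) ^ (1 / 2 : ℝ) * (K * a) ^ (1 / 2 : ℝ) := by
      calc a = ‖∫ x, G x * conj (𝓕 h (Ψ x)) ∂μ‖ₑ := by rw [e1, e2]
        _ ≤ ∫⁻ x, ‖G x * conj (𝓕 h (Ψ x))‖ₑ ∂μ := enorm_integral_le_lintegral_enorm _
        _ ≤ ∫⁻ x, F x * (ρ x * ‖𝓕 h (Ψ x)‖ₑ) ∂μ := by
            refine lintegral_mono fun x => ?_
            rw [enorm_mul, ← mul_assoc]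
            have : ‖conj (𝓕 h (Ψ x))‖ₑ = ‖𝓕 h (Ψ x)‖ₑ := by
              rw [← ofReal_norm, ← ofReal_norm, RCLike.norm_conj]
            rw [this]
            gcongr
            exact hle x
        _ ≤ (∫⁻ x, F x ^ (2 : ℝ) ∂μ) ^ (1 / (2 : ℝ)) *
            (∫⁻ x, (ρ x * ‖𝓕 h (Ψ x)‖ₑ) ^ (2 : ℝ) ∂μ) ^ (1 / (2 : ℝ)) :=
            ENNReal.lintegral_mul_le_Lp_mul_Lq μ Real.HolderConjugate.two_two hF.aemeasurable
              (hρ.mul (hFh.comp hΨ).enorm).aemeasurable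
        _ ≤ _ := by
            simp only [ENNReal.rpow_two, mul_pow]
            gcongr
            -- Plancherel turns `a` into the integral of |𝓕 h|², the function to which the density
            -- bound `hK` is applied.
            rw [ha, ← lintegral_enorm_fourier_sq h1 h2]
            exact hK (fun v => ‖𝓕 h v‖ₑ ^ 2) (hFh.enorm.pow_const 2)
    rw [haB]
    rcases eq_or_ne a 0 with h0 | h0
    · simp [h0]
    · rw [← ENNReal.mul_rpow_of_nonneg _ _ (by norm_num)] at e3
      have e4 : a ^ (2 : ℝ) ≤ (∫⁻ x, F x ^ 2 ∂μ) * (K * a) := by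
        have := ENNReal.rpow_le_rpow e3 (show (0 : ℝ) ≤ 2 by norm_num)
        rwa [← ENNReal.rpow_mul, show (1 / 2 : ℝ) * 2 = 1 by norm_num, ENNReal.rpow_one] at this
      rw [ENNReal.rpow_two, pow_two] at e4
      refine (ENNReal.mul_le_mul_iff_left h0 hafin).1 (e4.trans_eq ?_)
      ring
  refine le_of_tendsto' ((aecover_closedBall (μ := (volume : Measure V)) (x := (0 : V))
    (r := fun n : ℕ => (n : ℝ)) tendsto_natCast_atTop_atTop).lintegral_tendsto_of_nat
      (f := fun v => ‖w v‖ₑ ^ 2) ?_) (fun n => main n)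
  exact (hwc.measurable.enorm.pow_const 2).aemeasurable

end Duality

/-! ### Planar quadratic phases and slicing of Euclidean space -/

section Geometry

open scoped ENNReal

/-- In polar coordinates ρ dρ = d(ρ²)/2, so planar Lebesgue measure pushed forward by c + l|v - m|²
has constant density π/|l| on a half-line; extending to all of ℝ gives the inequality. The constancy
is special to two variables. -/
theorem lintegral_comp_add_mul_sq_le {H : ℝ → ℝ≥0∞} (hH : Measurable H) (c : ℝ) {l : ℝ}
    (hl : l ≠ 0) (m : ℝ × ℝ) :
    ∫⁻ v : ℝ × ℝ, H (c + l * ((v.1 - m.1) ^ 2 + (v.2 - m.2) ^ 2)) ≤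
      ENNReal.ofReal (Real.pi / |l|) * ∫⁻ t, H t := by
  have h1 : ∫⁻ v : ℝ × ℝ, H (c + l * ((v.1 - m.1) ^ 2 + (v.2 - m.2) ^ 2)) =
      ∫⁻ v : ℝ × ℝ, H (c + l * (v.1 ^ 2 + v.2 ^ 2)) :=
    lintegral_sub_right_eq_self (fun v : ℝ × ℝ => H (c + l * (v.1 ^ 2 + v.2 ^ 2))) m
  have hder : ∀ x ∈ Set.Ioi (0 : ℝ), HasDerivWithinAt (fun x => c + l * x ^ 2) (l * (2 * x))
      (Set.Ioi 0) x := fun x _ => by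
    have := (((hasDerivAt_pow 2 x).const_mul l).const_add c).hasDerivWithinAt (s := Set.Ioi 0)
    simpa using this
  have hinj : Set.InjOn (fun x => c + l * x ^ 2) (Set.Ioi (0 : ℝ)) := by
    intro x hx y hy hxy
    have : l * x ^ 2 = l * y ^ 2 := by simpa using hxy
    have h2 : x ^ 2 = y ^ 2 := mul_left_cancel₀ hl this
    exact (pow_left_inj₀ (le_of_lt hx) (le_of_lt hy) two_ne_zero).1 h2
  have h2 : ∫⁻ x in Set.Ioi (0 : ℝ), ENNReal.ofReal x * H (c + l * x ^ 2) ≤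
      ENNReal.ofReal (1 / (2 * |l|)) * ∫⁻ t, H t := by
    calc ∫⁻ x in Set.Ioi (0 : ℝ), ENNReal.ofReal x * H (c + l * x ^ 2)
        = ∫⁻ x in Set.Ioi (0 : ℝ), ENNReal.ofReal (1 / (2 * |l|)) *
            (ENNReal.ofReal |l * (2 * x)| * H (c + l * x ^ 2)) := by
          refine setLIntegral_congr_fun measurableSet_Ioi fun x hx => ?_
          rw [← mul_assoc, ← ENNReal.ofReal_mul (by positivity)]
          congr 2
          have : (0 : ℝ) < |l| := abs_pos.2 hl
          rw [abs_mul, abs_of_pos (by simpa using hx : (0 : ℝ) < 2 * x)]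
          field_simp
      _ = ENNReal.ofReal (1 / (2 * |l|)) *
            ∫⁻ t in (fun x => c + l * x ^ 2) '' Set.Ioi (0 : ℝ), H t := by
          rw [lintegral_const_mul _ (by fun_prop),
            lintegral_image_eq_lintegral_abs_deriv_mul measurableSet_Ioi hder hinj]
      _ ≤ _ := by
          gcongr
          exact Measure.restrict_le_self
  rw [h1, ← lintegral_comp_polarCoord_symm]
  calc ∫⁻ p in polarCoord.target, ENNReal.ofReal p.1 •
        H (c + l * ((polarCoord.symm p).1 ^ 2 + (polarCoord.symm p).2 ^ 2))
      = ∫⁻ p in (Set.Ioi (0 : ℝ) ×ˢ Set.Ioo (-Real.pi) Real.pi),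
          ENNReal.ofReal p.1 * H (c + l * p.1 ^ 2) := by
        refine setLIntegral_congr_fun polarCoord.open_target.measurableSet fun p _ => ?_
        simp only [polarCoord_symm_apply, smul_eq_mul]
        congr 4
        have := Real.cos_sq_add_sin_sq p.2
        linear_combination p.1 ^ 2 * this
    _ = ENNReal.ofReal (2 * Real.pi) *
          ∫⁻ x in Set.Ioi (0 : ℝ), ENNReal.ofReal x * H (c + l * x ^ 2) := by
        rw [Measure.volume_eq_prod, ← Measure.prod_restrict, lintegral_prod _ (by fun_prop)]
        simp only [lintegral_const, MeasurableSet.univ, Measure.restrict_apply, Set.univ_inter,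
          Real.volume_Ioo]
        rw [lintegral_mul_const _ (by fun_prop), mul_comm]
        congr 2
        ring
    _ ≤ ENNReal.ofReal (2 * Real.pi) * (ENNReal.ofReal (1 / (2 * |l|)) * ∫⁻ t, H t) := by gcongr
    _ = _ := by
        rw [← mul_assoc, ← ENNReal.ofReal_mul (by positivity)]
        congr 2
        have : (0 : ℝ) < |l| := abs_pos.2 hl
        field_simp

theorem lintegral_fin_succ {n : ℕ} {f : (Fin (n + 1) → ℝ) → ℝ≥0∞} (hf : Measurable f) :
    ∫⁻ k, f k = ∫⁻ a : ℝ, ∫⁻ y : Fin n → ℝ, f (Fin.cons a y) := by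
  have hm : Measurable fun p : ℝ × (Fin n → ℝ) => f (Fin.cons p.1 p.2) :=
    hf.comp (Continuous.measurable (by fun_prop))
  rw [← lintegral_prod _ hm.aemeasurable, ← Measure.volume_eq_prod,
    ← (volume_preserving_piFinSuccAbove (fun _ : Fin (n + 1) => ℝ) 0).symm.lintegral_comp hf]
  simp [Fin.consEquiv]

theorem lintegral_fin_add_two {n : ℕ} {f : (Fin (n + 2) → ℝ) → ℝ≥0∞} (hf : Measurable f) :
    ∫⁻ k, f k = ∫⁻ y : Fin n → ℝ, ∫⁻ v : ℝ × ℝ, f (Fin.cons v.1 (Fin.cons v.2 y)) := by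
  have hm : Measurable fun p : (Fin n → ℝ) × ℝ × ℝ =>
      f (Fin.cons p.2.1 (Fin.cons p.2.2 p.1 : Fin (n + 1) → ℝ)) :=
    hf.comp (Continuous.measurable (by fun_prop))
  rw [lintegral_lintegral_swap hm.aemeasurable, lintegral_fin_succ hf, Measure.volume_eq_prod,
    lintegral_prod _ (Measurable.lintegral_prod_left' hm).aemeasurable]
  refine lintegral_congr fun b => ?_
  rw [lintegral_fin_succ]
  exact hf.comp (Continuous.measurable (by fun_prop))

/-- Tonelli's theorem on `ℝ^(n+3)`, with the second and third coordinates innermost. -/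
theorem lintegral_euclideanSpace_fin_add_three {n : ℕ} {f : EuclideanSpace ℝ (Fin (n + 3)) → ℝ≥0∞}
    (hf : Measurable f) :
    ∫⁻ k, f k = ∫⁻ a : ℝ, ∫⁻ y : Fin n → ℝ, ∫⁻ v : ℝ × ℝ,
      f (WithLp.toLp 2 (Fin.cons a (Fin.cons v.1 (Fin.cons v.2 y)))) := by
  have hm : Measurable fun x : Fin (n + 3) → ℝ => f (WithLp.toLp 2 x) :=
    hf.comp (PiLp.continuous_toLp 2 _).measurable
  rw [← (PiLp.volume_preserving_toLp (Fin (n + 3))).lintegral_comp hf, lintegral_fin_succ hm]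
  refine lintegral_congr fun a => ?_
  rw [lintegral_fin_add_two]
  exact hm.comp (Continuous.measurable (by fun_prop))

end Geometry

/-! ### The summed phase and the density of its push-forward -/

section Phase

open scoped ENNReal

/-- The dispersion relation of the Zakharov–Kuznetsov equation in the normalization of `𝓕`. -/
noncomputable def zkPhase {d : ℕ} [NeZero d] (k : ZK.Space d) : ℝ :=
  4 * Real.pi ^ 2 * (k 0 * ‖k‖ ^ 2)

theorem continuous_zkPhase {d : ℕ} [NeZero d] : Continuous (zkPhase (d := d)) := by
  unfold zkPhase
  fun_prop

/-- Along a fiber `k₁ + k₂ = ζ` with `ζ₀ ≠ 0`, the sum of the phases is a multiple of a squared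
distance as a function of two transverse coordinates. -/
theorem exists_zkPhase_add_eq {n : ℕ} {ζ : ZK.Space (n + 3)} (hζ : ζ 0 ≠ 0) (a : ℝ)
    (y : Fin n → ℝ) :
    ∃ (c : ℝ) (m : ℝ × ℝ), ∀ v : ℝ × ℝ,
      let k : ZK.Space (n + 3) := WithLp.toLp 2 (Fin.cons a (Fin.cons v.1 (Fin.cons v.2 y)))
      zkPhase k + zkPhase (ζ - k) =
        c + 4 * Real.pi ^ 2 * ζ 0 * ((v.1 - m.1) ^ 2 + (v.2 - m.2) ^ 2) := by
  -- Completing the square in a b² + (ζ₀ - a)(z - b)² puts the vertex at b = e z. The leading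
  -- coefficient a + (ζ₀ - a) = ζ₀ does not depend on a.
  set e := (ζ 0 - a) / ζ 0 with he
  have hea : ζ 0 - a = ζ 0 * e := by rw [he]; field_simp
  have hea' : a = ζ 0 - ζ 0 * e := by linarith
  refine ⟨4 * Real.pi ^ 2 * (a * (a ^ 2 + ∑ j, y j ^ 2) + (ζ 0 - a) * ((ζ 0 - a) ^ 2 +
    ∑ j : Fin n, (ζ j.succ.succ.succ - y j) ^ 2) + ζ 0 * (e - e ^ 2) * (ζ 1 ^ 2 + ζ 2 ^ 2)),
    (e * ζ 1, e * ζ 2), fun v => ?_⟩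
  simp only [zkPhase, EuclideanSpace.real_norm_sq_eq, Fin.sum_univ_succ (n := n + 2),
    Fin.sum_univ_succ (n := n + 1), Fin.sum_univ_succ (n := n), PiLp.sub_apply, Fin.cons_zero,
    Fin.cons_succ]
  rw [show (Fin.succ (0 : Fin (n + 2))) = 1 from rfl,
    show (Fin.succ (Fin.succ (0 : Fin (n + 1)))) = 2 from rfl]
  rw [hea]
  have h : ∀ b z : ℝ, a * b ^ 2 + ζ 0 * e * (z - b) ^ 2 =
      ζ 0 * (b - e * z) ^ 2 + ζ 0 * (e - e ^ 2) * z ^ 2 := fun b z => by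
    rw [hea']; ring
  have h1 := h v.1 (ζ 1)
  have h2 := h v.2 (ζ 2)
  linear_combination 4 * Real.pi ^ 2 * h1 + 4 * Real.pi ^ 2 * h2

/-- The left side is nondecreasing for z ≤ r and nonincreasing for z ≥ r, with value r^s at z = r.
It is applied with 4s in place of s, which is where s ≤ 1/4 enters. -/
theorem min_mul_rpow_le {r z s : ℝ} (hr : 0 < r) (hz : 0 < z) (hs : 0 ≤ s) (hs' : s ≤ 1) :
    min r z * (z ^ s / z) ≤ r ^ s := by
  rw [← Real.rpow_sub_one hz.ne']
  rcases le_total z r with h | h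
  · rw [min_eq_right h, Real.rpow_sub_one hz.ne', mul_div_cancel₀ _ hz.ne']
    exact Real.rpow_le_rpow hz.le h hs
  · rw [min_eq_left h]
    calc r * z ^ (s - 1) ≤ r * r ^ (s - 1) := by
          gcongr ?_ * ?_
          exact Real.rpow_le_rpow_of_nonpos hr h (by linarith)
      _ = r ^ s := by rw [Real.rpow_sub_one hr.ne', mul_div_cancel₀ _ hr.ne']

/-- The weight `|k₁₀|ˢ |k₂₀|ˢ`, restricted to pairs of frequencies in a ball whose first
coordinates have the same sign. -/
noncomputable def sameSignWeight {d : ℕ} [NeZero d] (s : ℝ) (q : ZK.Space d) (r : ℝ) :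
    ZK.Space d × ZK.Space d → ℝ≥0∞ :=
  Set.indicator {x | x.1 ∈ Metric.ball q r ∧ x.2 ∈ Metric.ball q r ∧ 0 < x.1 0 * x.2 0}
    fun x => ENNReal.ofReal (|x.1 0| ^ s * |x.2 0| ^ s)

theorem measurable_sameSignWeight {d : ℕ} [NeZero d] (s : ℝ) (q : ZK.Space d) (r : ℝ) :
    Measurable (sameSignWeight s q r) := by
  refine Measurable.indicator (by fun_prop) ?_
  refine (measurableSet_ball.preimage measurable_fst).inter
    ((measurableSet_ball.preimage measurable_snd).inter ?_)
  have h : Measurable fun x : ZK.Space d × ZK.Space d => x.1 0 * x.2 0 := by fun_prop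
  exact measurableSet_lt measurable_const h

/-- Four factors multiply: density 1/(4π|ζ₀|) from two transverse coordinates, length 2 min(r, |ζ₀|)
from the first coordinate, (2r)^n from the remaining ones, and |ζ₀|^{4s} from the squared weight. -/
theorem lintegral_fiber_le {n : ℕ} {s : ℝ} (hs : 0 ≤ s) (hs' : s ≤ 1 / 4) (q : ZK.Space (n + 3))
    {r : ℝ} (hr : 0 < r) (ζ : ZK.Space (n + 3)) {H : ℝ → ℝ≥0∞} (hH : Measurable H) :
    ∫⁻ k, sameSignWeight s q r (k, ζ - k) ^ 2 * H (zkPhase k + zkPhase (ζ - k)) ≤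
      ENNReal.ofReal (2 ^ (n + 1) * r ^ (n + 4 * s)) * ∫⁻ t, H t := by
  have hph := continuous_zkPhase (d := n + 3)
  have hmw := measurable_sameSignWeight s q r
  rcases eq_or_ne (ζ 0) 0 with h0 | h0
  -- If ζ₀ = 0 the two first coordinates are opposite, so the weight vanishes on the whole fiber.
  · have : ∀ k, sameSignWeight s q r (k, ζ - k) = 0 := fun k => by
      refine Set.indicator_of_notMem (fun h => ?_) _
      have := h.2.2
      simp only [PiLp.sub_apply, h0] at this
      nlinarith [mul_self_nonneg (k 0)]
    simp [this]
  have hz : 0 < |ζ 0| := abs_pos.2 h0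
  set A : Set ℝ := Metric.ball (q 0) r ∩ Metric.ball 0 |ζ 0|
  have hA : MeasurableSet A := measurableSet_ball.inter measurableSet_ball
  set B : Set (Fin n → ℝ) := Metric.ball (fun j => q j.succ.succ.succ) r
  have hB : MeasurableSet B := measurableSet_ball
  set W : ℝ≥0∞ := ENNReal.ofReal (|ζ 0| ^ (4 * s)) with hW
  have hbound : ∀ (a : ℝ) (y : Fin n → ℝ) (v : ℝ × ℝ),
      let k : ZK.Space (n + 3) := WithLp.toLp 2 (Fin.cons a (Fin.cons v.1 (Fin.cons v.2 y)))
      sameSignWeight s q r (k, ζ - k) ^ 2 ≤ A.indicator 1 a * B.indicator 1 y * W := by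
    intro a y v k
    by_cases hk : (k, ζ - k) ∈ {x : ZK.Space (n + 3) × ZK.Space (n + 3) |
        x.1 ∈ Metric.ball q r ∧ x.2 ∈ Metric.ball q r ∧ 0 < x.1 0 * x.2 0}
    · rw [sameSignWeight, Set.indicator_of_mem hk]
      obtain ⟨hk1, -, hk3⟩ := hk
      have hka : k 0 = a := rfl
      have hcoord : ∀ i, |k i - q i| < r := fun i => by
        have h1 := PiLp.norm_apply_le (k - q) i
        rw [PiLp.sub_apply, Real.norm_eq_abs] at h1
        exact h1.trans_lt (by simpa [dist_eq_norm] using hk1)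
      simp only [PiLp.sub_apply, hka] at hk3
      -- By `hk3`, a(ζ₀ - a) > 0, so ζ₀² exceeds both a² and (ζ₀ - a)².
      have h1 : |a| ≤ |ζ 0| := sq_le_sq.1 (by nlinarith [sq_nonneg (ζ 0 - a)])
      have h1' : |a| < |ζ 0| := sq_lt_sq.1 (by nlinarith [sq_nonneg (ζ 0 - a)])
      have h2 : |ζ 0 - a| ≤ |ζ 0| := sq_le_sq.1 (by nlinarith [sq_nonneg a])
      have haA : a ∈ A := ⟨by simpa [Real.dist_eq, hka] using hcoord 0, by simpa using h1'⟩
      have hyB : y ∈ B := by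
        rw [Metric.mem_ball, dist_pi_lt_iff hr]
        exact fun j => by simpa [Real.dist_eq, k] using hcoord j.succ.succ.succ
      simp only [haA, hyB, Set.indicator_of_mem, Pi.one_apply, one_mul, PiLp.sub_apply, hka]
      rw [hW, ← ENNReal.ofReal_pow (by positivity)]
      refine ENNReal.ofReal_le_ofReal ?_
      calc (|a| ^ s * |ζ 0 - a| ^ s) ^ 2 ≤ (|ζ 0| ^ s * |ζ 0| ^ s) ^ 2 := by gcongr
        _ = |ζ 0| ^ (4 * s) := by
            rw [mul_comm 4 s, Real.rpow_mul hz.le, show (4 : ℝ) = ((4 : ℕ) : ℝ) by norm_num,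
              Real.rpow_natCast]
            ring
    · rw [sameSignWeight, Set.indicator_of_notMem hk]
      simp
  have hvolA : volume A ≤ ENNReal.ofReal (2 * min r |ζ 0|) := by
    rw [mul_min_of_nonneg _ _ zero_le_two, ENNReal.ofReal_min]
    exact le_min ((measure_mono Set.inter_subset_left).trans_eq (Real.volume_ball _ _))
      ((measure_mono Set.inter_subset_right).trans_eq (Real.volume_ball _ _))
  have hvolB : volume B = ENNReal.ofReal ((2 * r) ^ n) := by
    rw [Real.volume_pi_ball _ hr, Fintype.card_fin]
  have hl : 4 * Real.pi ^ 2 * ζ 0 ≠ 0 := by positivity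
  set D : ℝ≥0∞ := ENNReal.ofReal (Real.pi / |4 * Real.pi ^ 2 * ζ 0|) with hD
  have hmeas : Measurable fun k : ZK.Space (n + 3) =>
      sameSignWeight s q r (k, ζ - k) ^ 2 * H (zkPhase k + zkPhase (ζ - k)) :=
    ((hmw.comp (by fun_prop)).pow_const 2).mul (hH.comp (Continuous.measurable (by fun_prop)))
  rw [lintegral_euclideanSpace_fin_add_three hmeas]
  calc _ ≤ ∫⁻ a : ℝ, ∫⁻ y : Fin n → ℝ, A.indicator 1 a * (B.indicator 1 y *
        (W * (D * ∫⁻ t, H t))) := by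
        refine lintegral_mono fun a => lintegral_mono fun y => ?_
        obtain ⟨c, m, hcm⟩ := exists_zkPhase_add_eq h0 a y
        simp only at hcm
        calc _ ≤ ∫⁻ v : ℝ × ℝ, A.indicator 1 a * B.indicator 1 y * W *
              H (c + 4 * Real.pi ^ 2 * ζ 0 * ((v.1 - m.1) ^ 2 + (v.2 - m.2) ^ 2)) := by
              refine lintegral_mono fun v => ?_
              rw [hcm]
              gcongr
              exact hbound a y v
          _ ≤ A.indicator 1 a * B.indicator 1 y * W * (D * ∫⁻ t, H t) := by
              rw [lintegral_const_mul _ (by fun_prop)]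
              gcongr
              exact lintegral_comp_add_mul_sq_le hH c hl m
          _ = _ := by ring
    _ = volume A * (volume B * (W * (D * ∫⁻ t, H t))) := by
        simp_rw [lintegral_const_mul _ ((measurable_one.indicator hB).mul_const _),
          lintegral_mul_const _ (measurable_one.indicator hB), lintegral_indicator_one hB]
        rw [lintegral_mul_const _ (measurable_one.indicator hA), lintegral_indicator_one hA]
    _ ≤ ENNReal.ofReal (2 * min r |ζ 0|) * (ENNReal.ofReal ((2 * r) ^ n) *
          (W * (D * ∫⁻ t, H t))) := by
        rw [hvolB]
        gcongr
    _ = ENNReal.ofReal (2 * min r |ζ 0| * ((2 * r) ^ n * (|ζ 0| ^ (4 * s) *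
          (Real.pi / |4 * Real.pi ^ 2 * ζ 0|)))) * ∫⁻ t, H t := by
        rw [ENNReal.ofReal_mul (p := 2 * min r |ζ 0|) (by positivity),
          ENNReal.ofReal_mul (p := (2 * r) ^ n) (by positivity),
          ENNReal.ofReal_mul (p := |ζ 0| ^ (4 * s)) (by positivity)]
        simp only [mul_assoc, hW, hD]
    _ ≤ _ := by
        refine mul_le_mul_left (ENNReal.ofReal_le_ofReal ?_) _
        have h1 := min_mul_rpow_le hr hz (s := 4 * s) (by linarith) (by linarith)
        have hpi : 1 ≤ 4 * Real.pi := by linarith [Real.pi_gt_three]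
        rw [abs_mul, abs_of_pos (by positivity : (0 : ℝ) < 4 * Real.pi ^ 2),
          Real.rpow_add hr, Real.rpow_natCast]
        calc _ = 2 ^ (n + 1) * (r ^ n * (min r |ζ 0| * (|ζ 0| ^ (4 * s) / |ζ 0|))) /
              (4 * Real.pi) := by
              rw [mul_pow]
              field_simp
              ring
          _ ≤ 2 ^ (n + 1) * (r ^ n * (min r |ζ 0| * (|ζ 0| ^ (4 * s) / |ζ 0|))) :=
              div_le_self (by positivity) hpi
          _ ≤ _ := by gcongr

/-- The weighted push-forward of Lebesgue measure under
`(k₁, k₂) ↦ (ψ(k₁) + ψ(k₂), k₁ + k₂)` has a bounded density. -/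
theorem lintegral_sameSignWeight_le {n : ℕ} {s : ℝ} (hs : 0 ≤ s) (hs' : s ≤ 1 / 4)
    (q : ZK.Space (n + 3)) {r : ℝ} (hr : 0 < r)
    {h : WithLp 2 (ℝ × ZK.Space (n + 3)) → ℝ≥0∞} (hh : Measurable h) :
    ∫⁻ x : ZK.Space (n + 3) × ZK.Space (n + 3), sameSignWeight s q r x ^ 2 *
      h (WithLp.toLp 2 (zkPhase x.1 + zkPhase x.2, x.1 + x.2)) ≤
      ENNReal.ofReal (2 ^ (n + 1) * r ^ (n + 4 * s)) * ∫⁻ v, h v := by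
  have hph := continuous_zkPhase (d := n + 3)
  have hmw := measurable_sameSignWeight s q r
  have hh' : Measurable fun p : ℝ × ZK.Space (n + 3) => h (WithLp.toLp 2 p) :=
    hh.comp (WithLp.prod_continuous_toLp 2 _ _).measurable
  have hm : Measurable fun x : ZK.Space (n + 3) × ZK.Space (n + 3) => sameSignWeight s q r x ^ 2 *
      h (WithLp.toLp 2 (zkPhase x.1 + zkPhase x.2, x.1 + x.2)) :=
    (hmw.pow_const 2).mul (hh'.comp (Continuous.measurable (by fun_prop)))
  have hm' : Measurable fun x : ZK.Space (n + 3) × ZK.Space (n + 3) =>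
      sameSignWeight s q r (x.1, x.2 - x.1) ^ 2 *
      h (WithLp.toLp 2 (zkPhase x.1 + zkPhase (x.2 - x.1), x.2)) :=
    ((hmw.comp (by fun_prop)).pow_const 2).mul (hh'.comp (Continuous.measurable (by fun_prop)))
  rw [← (WithLp.volume_preserving_toLp ℝ (ZK.Space (n + 3))).lintegral_comp hh,
    Measure.volume_eq_prod, lintegral_prod _ hm.aemeasurable, Measure.volume_eq_prod,
    lintegral_prod_symm _ hh'.aemeasurable]
  -- The measure-preserving shear k₂ = ζ - k slices the pairs by their sum ζ, reducing the bound to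
  -- one fiber at a time.
  calc _ = ∫⁻ k, ∫⁻ ζ, sameSignWeight s q r (k, ζ - k) ^ 2 *
        h (WithLp.toLp 2 (zkPhase k + zkPhase (ζ - k), ζ)) := by
        refine lintegral_congr fun k => ?_
        rw [← lintegral_sub_right_eq_self _ k]
        simp
    _ = ∫⁻ ζ, ∫⁻ k, sameSignWeight s q r (k, ζ - k) ^ 2 *
        h (WithLp.toLp 2 (zkPhase k + zkPhase (ζ - k), ζ)) :=
        lintegral_lintegral_swap hm'.aemeasurable
    _ ≤ ∫⁻ ζ, ENNReal.ofReal (2 ^ (n + 1) * r ^ (n + 4 * s)) *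
        ∫⁻ t, h (WithLp.toLp 2 (t, ζ)) := by
        refine lintegral_mono fun ζ => ?_
        exact lintegral_fiber_le hs hs' q hr ζ (hh'.comp (by fun_prop : Measurable fun t => (t, ζ)))
    _ = _ := lintegral_const_mul _ (Measurable.lintegral_prod_left' hh')

end Phase

/-! ### The explicit solution and its L⁴ bound -/

section Evolution

open scoped ENNReal

/-- The solution of the linear Zakharov–Kuznetsov equation whose Fourier transform at time `t` is
`|2πk₀|ˢ exp(2πitψ(k)) g(k)`, with `ψ = zkPhase`. -/
noncomputable def zkEvolution {d : ℕ} [NeZero d] (s : ℝ) (g : ZK.Space d → ℂ)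
    (w : ℝ × ZK.Space d) : ℂ :=
  ∫ k, 𝐞 (inner ℝ k w.2 + w.1 * zkPhase k) • (((|2 * Real.pi * k 0| ^ s : ℝ) : ℂ) * g k)

variable {d : ℕ} [NeZero d]

theorem integrable_weight_mul {s : ℝ} (hs : 0 ≤ s) {q : ZK.Space d} {r : ℝ} {g : ZK.Space d → ℂ}
    (hg : MemLp g 2) (hsupp : Function.support g ⊆ Metric.ball q r) :
    Integrable fun k => ((|2 * Real.pi * k 0| ^ s : ℝ) : ℂ) * g k := by
  have : IsFiniteMeasure (volume.restrict (Metric.ball q r)) :=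
    ⟨by simpa using measure_ball_lt_top⟩
  have hgi : Integrable g := (integrableOn_iff_integrable_of_support_subset hsupp).1
    ((hg.restrict (Metric.ball q r)).integrable one_le_two)
  have hw : Continuous fun k : ZK.Space d => |2 * Real.pi * k 0| ^ s := by
    refine Continuous.rpow_const (by fun_prop) fun _ => Or.inr hs
  refine (hgi.norm.const_mul ((2 * Real.pi * (‖q‖ + r)) ^ s)).mono'
    ((Complex.continuous_ofReal.comp hw).aestronglyMeasurable.mul hg.1)
    (Filter.Eventually.of_forall fun k => ?_)
  rw [norm_mul, Complex.norm_real, Real.norm_of_nonneg (by positivity)]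
  by_cases hk : g k = 0
  · simp [hk]
  have hkb : ‖k - q‖ < r := by simpa [dist_eq_norm] using hsupp hk
  have h1 : |k 0| ≤ ‖k‖ := by simpa using PiLp.norm_apply_le k 0
  have h2 : ‖k‖ ≤ ‖k - q‖ + ‖q‖ := by simpa using norm_add_le (k - q) q
  gcongr
  rw [abs_mul, abs_of_pos (by positivity : (0 : ℝ) < 2 * Real.pi)]
  gcongr
  linarith

theorem continuous_zkEvolution {s : ℝ} {g : ZK.Space d → ℂ}
    (hg : Integrable fun k => ((|2 * Real.pi * k 0| ^ s : ℝ) : ℂ) * g k) :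
    Continuous (zkEvolution s g) := by
  have hph := continuous_zkPhase (d := d)
  have hch := Real.continuous_fourierChar
  refine continuous_of_dominated (fun w => ?_) (fun w => ?_) hg.norm ?_
  · exact (hch.comp (by fun_prop)).aestronglyMeasurable.smul hg.1
  · exact Filter.Eventually.of_forall fun k => by rw [Circle.norm_smul]
  · exact Filter.Eventually.of_forall fun k => by fun_prop

theorem zkEvolution_add {s : ℝ} {g₁ g₂ : ZK.Space d → ℂ}
    (hg₁ : Integrable fun k => ((|2 * Real.pi * k 0| ^ s : ℝ) : ℂ) * g₁ k)
    (hg₂ : Integrable fun k => ((|2 * Real.pi * k 0| ^ s : ℝ) : ℂ) * g₂ k) :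
    zkEvolution s (g₁ + g₂) = zkEvolution s g₁ + zkEvolution s g₂ := by
  have hph := continuous_zkPhase (d := d)
  have hch := Real.continuous_fourierChar
  have key : ∀ (w : ℝ × ZK.Space d) {f : ZK.Space d → ℂ}, Integrable f →
      Integrable fun k => 𝐞 (inner ℝ k w.2 + w.1 * zkPhase k) • f k := fun w f hf =>
    hf.mono ((hch.comp (by fun_prop)).aestronglyMeasurable.smul hf.1)
      (Filter.Eventually.of_forall fun k => by rw [Circle.norm_smul])
  ext w
  simp only [zkEvolution, Pi.add_apply, mul_add, smul_add]
  exact integral_add (key w hg₁) (key w hg₂)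

/-- The `L⁴` estimate for data in a ball, with first frequencies of constant sign. -/
theorem lintegral_enorm_zkEvolution_pow_four_le {n : ℕ} {s : ℝ} (hs : 0 ≤ s) (hs' : s ≤ 1 / 4)
    {q : ZK.Space (n + 3)} {r : ℝ} (hr : 0 < r) {g : ZK.Space (n + 3) → ℂ} (hgm : Measurable g)
    (hg : MemLp g 2) (hsupp : Function.support g ⊆ Metric.ball q r)
    (hsign : ∀ k₁ k₂, g k₁ ≠ 0 → g k₂ ≠ 0 → 0 < k₁ 0 * k₂ 0) :
    ∫⁻ w, ‖zkEvolution s g w‖ₑ ^ 4 ≤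
      ENNReal.ofReal (2 ^ (n + 1) * r ^ (n + 4 * s) * (2 * Real.pi) ^ (4 * s)) *
        (∫⁻ k, ‖g k‖ₑ ^ 2) ^ 2 := by
  have hph := continuous_zkPhase (d := n + 3)
  set A : ZK.Space (n + 3) → ℂ := fun k => ((|2 * Real.pi * k 0| ^ s : ℝ) : ℂ) * g k with hA
  have hAi : Integrable A := integrable_weight_mul hs hg hsupp
  set Ψ : ZK.Space (n + 3) × ZK.Space (n + 3) → WithLp 2 (ℝ × ZK.Space (n + 3)) :=
    fun x => WithLp.toLp 2 (zkPhase x.1 + zkPhase x.2, x.1 + x.2) with hΨ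
  have hΨm : Measurable Ψ :=
    ((WithLp.prod_continuous_toLp 2 _ _).comp (by fun_prop)).measurable
  set c : ℝ := (2 * Real.pi) ^ s with hc
  have hc0 : 0 ≤ c := by positivity
  set F : ZK.Space (n + 3) × ZK.Space (n + 3) → ℝ≥0∞ :=
    fun x => ENNReal.ofReal (c ^ 2) * (‖g x.1‖ₑ * ‖g x.2‖ₑ) with hF
  have hFm : Measurable F := by fun_prop
  have hle : ∀ x : ZK.Space (n + 3) × ZK.Space (n + 3),
      ‖A x.1 * A x.2‖ₑ ≤ F x * sameSignWeight s q r x := by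
    intro x
    by_cases h1 : g x.1 = 0
    · simp [hA, h1]
    by_cases h2 : g x.2 = 0
    · simp [hA, h2]
    have hx : x ∈ {x : ZK.Space (n + 3) × ZK.Space (n + 3) | x.1 ∈ Metric.ball q r ∧
        x.2 ∈ Metric.ball q r ∧ 0 < x.1 0 * x.2 0} := ⟨hsupp h1, hsupp h2, hsign _ _ h1 h2⟩
    rw [sameSignWeight, Set.indicator_of_mem hx]
    simp only [hA, hF, enorm_mul]
    have e : ∀ k : ZK.Space (n + 3), ‖((|2 * Real.pi * k 0| ^ s : ℝ) : ℂ)‖ₑ =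
        ENNReal.ofReal (c * |k 0| ^ s) := fun k => by
      rw [← ofReal_norm, Complex.norm_real, Real.norm_of_nonneg (by positivity), abs_mul,
        abs_of_pos (by positivity : (0 : ℝ) < 2 * Real.pi),
        Real.mul_rpow (by positivity) (abs_nonneg _)]
    rw [e, e, ENNReal.ofReal_mul hc0, ENNReal.ofReal_mul hc0, ENNReal.ofReal_pow hc0,
      ENNReal.ofReal_mul (by positivity)]
    apply le_of_eq
    ring
  -- The square of the solution is one oscillatory integral over pairs, so its L⁴ norm becomes an L²
  -- norm.
  have hsq : ∀ w : ℝ × ZK.Space (n + 3), ∫ x : ZK.Space (n + 3) × ZK.Space (n + 3),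
      𝐞 (inner ℝ (Ψ x) (WithLp.toLp 2 w)) • (A x.1 * A x.2) = zkEvolution s g w ^ 2 := by
    intro w
    rw [pow_two, zkEvolution, Measure.volume_eq_prod, ← integral_prod_mul]
    refine integral_congr_ae (Filter.Eventually.of_forall fun x => ?_)
    simp only [hΨ, WithLp.prod_inner_apply, inner_add_left]
    rw [smul_mul_smul_comm, ← AddChar.map_add_eq_mul]
    congr 2
    simp only [RCLike.inner_apply, conj_trivial]
    ring
  have hmain := lintegral_enorm_oscillatory_sq_le (μ := volume) hΨm (hAi.mul_prod hAi)
    (measurable_sameSignWeight s q r) hFm hle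
    (fun h hh => lintegral_sameSignWeight_le hs hs' q hr hh)
  rw [← (WithLp.volume_preserving_toLp ℝ (ZK.Space (n + 3))).lintegral_comp_emb
    (MeasurableEquiv.toLp 2 _).measurableEmbedding] at hmain
  simp_rw [hsq] at hmain
  calc ∫⁻ w, ‖zkEvolution s g w‖ₑ ^ 4 = ∫⁻ w, ‖zkEvolution s g w ^ 2‖ₑ ^ 2 := by
        refine lintegral_congr fun w => ?_
        rw [enorm_pow, ← pow_mul]
    _ ≤ _ := hmain
    _ = _ := by
        have hg2 : AEMeasurable (fun k => ‖g k‖ₑ ^ 2) volume := by fun_prop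
        have : ∫⁻ x, F x ^ 2 = ENNReal.ofReal (c ^ 4) * (∫⁻ k, ‖g k‖ₑ ^ 2) ^ 2 := by
          simp only [hF, mul_pow]
          rw [lintegral_const_mul _ (by fun_prop), Measure.volume_eq_prod,
            lintegral_prod_mul hg2 hg2, ← ENNReal.ofReal_pow (by positivity),
            show (c ^ 2) ^ 2 = c ^ 4 by ring, pow_two (∫⁻ k, ‖g k‖ₑ ^ 2)]
        rw [this, ← mul_assoc, ← ENNReal.ofReal_mul (by positivity)]
        congr 3
        rw [hc, ← Real.rpow_mul_natCast (by positivity), mul_comm s]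
        norm_num

/-- The image of the dilated and propagated data under the inverse Fourier transform. -/
theorem absDx_propagator_ae_eq {s : ℝ} (hs : 0 ≤ s) (t : ℝ) (p : ZK.Space d) (r : ℝ) (f : ZK.L2 d)
    {g : ZK.Space d → ℂ} {q : ZK.Space d} {r' : ℝ} (hg : MemLp g 2)
    (hsupp : Function.support g ⊆ Metric.ball q r')
    (hgf : ((𝓕 (ZK.freqProj p r f) : ZK.L2 d) : ZK.Space d → ℂ) =ᵐ[volume] g) :
    (fun z => zkEvolution s g (t, z)) =ᵐ[volume]
      (ZK.absDx s (ZK.propagator t (ZK.freqProj p r f))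
        (ZK.inMultiplierDomain_absDx hs t p r f) : ZK.Space d → ℂ) := by
  have hph := continuous_zkPhase (d := d)
  have hch := Real.continuous_fourierChar
  set m : ZK.Space d → ℂ := fun k =>
    𝐞 (t * zkPhase k) • (((|2 * Real.pi * k 0| ^ s : ℝ) : ℂ) * g k) with hm
  -- At ξ = 2πk, tξ₀|ξ|² = 8π³ t k₀|k|² = 2π · tψ(k), which explains the factor 4π² in `zkPhase`.
  have hprop : ∀ k : ZK.Space d, ZK.propagatorSymbol t ((2 * Real.pi) • k) =
      (𝐞 (t * zkPhase k) : ℂ) := fun k => by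
    rw [ZK.propagatorSymbol, Real.fourierChar_apply, zkPhase, norm_smul,
      Real.norm_of_nonneg (by positivity), PiLp.smul_apply, smul_eq_mul]
    congr 1
    push_cast
    ring
  have hae : (fun k => ZK.absDxSymbol s ((2 * Real.pi) • k) *
      (𝓕 (ZK.propagator t (ZK.freqProj p r f)) : ZK.L2 d) k) =ᵐ[volume] m := by
    filter_upwards [hgf, ZK.fourier_fourierMultiplier (ZK.propagatorSymbol t) (ZK.freqProj p r f)
      (ZK.inMultiplierDomain_of_bounded (ZK.measurable_propagatorSymbol t)
        (ZK.norm_propagatorSymbol_le t) _)] with k h1 h2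
    rw [ZK.propagator, h2, h1, hprop, ZK.absDxSymbol, PiLp.smul_apply, smul_eq_mul, hm]
    simp only [Circle.smul_def, smul_eq_mul]
    ring
  have hA := integrable_weight_mul hs hg hsupp
  have hmi : Integrable m :=
    hA.mono ((hch.comp (by fun_prop)).aestronglyMeasurable.smul hA.1)
      (Filter.Eventually.of_forall fun k => by rw [hm, Circle.norm_smul])
  have hm2 : MemLp m 2 := (memLp_congr_ae hae).1 (ZK.inMultiplierDomain_absDx hs t p r f)
  have heq : ZK.absDx s (ZK.propagator t (ZK.freqProj p r f))
      (ZK.inMultiplierDomain_absDx hs t p r f) = 𝓕⁻ (hm2.toLp m : ZK.L2 d) := by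
    rw [ZK.absDx, ZK.fourierMultiplier]
    congr 1
    exact MemLp.toLp_congr _ _ hae
  rw [heq]
  filter_upwards [fourierInv_toLp_ae_eq hmi hm2] with z hz
  rw [hz, Real.fourierInv_eq, zkEvolution]
  refine integral_congr_ae (Filter.Eventually.of_forall fun k => ?_)
  simp only [hm]
  rw [smul_smul, ← AddChar.map_add_eq_mul]

theorem volume_setOf_apply_zero_eq_zero : volume {k : ZK.Space d | k 0 = 0} = 0 := by
  have h := Measure.addHaar_submodule (volume : Measure (ZK.Space d))
    (LinearMap.ker (EuclideanSpace.proj (𝕜 := ℝ) (0 : Fin d) : ZK.Space d →L[ℝ] ℝ).toLinearMap)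
    (fun h => by
      have : EuclideanSpace.single (0 : Fin d) (1 : ℝ) ∈
          LinearMap.ker (EuclideanSpace.proj (𝕜 := ℝ) (0 : Fin d)).toLinearMap := by
        rw [h]; trivial
      simp at this)
  convert h using 2
  ext k
  simp

/-- The fourth root of the L⁴ estimate at radius r/(2π), the radius of the ball in the frequency
variable of 𝓕. The powers of 2π combine to (2π)^{-n} ≤ 1. -/
theorem eLpNorm_zkEvolution_le {n : ℕ} {s : ℝ} (hs : 0 ≤ s) (hs' : s ≤ 1 / 4)
    {q : ZK.Space (n + 3)} {r : ℝ} (hr : 0 < r) (G : ZK.L2 (n + 3)) {S : Set (ZK.Space (n + 3))}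
    (hS : MeasurableSet S) (hSq : S ⊆ Metric.ball q (r / (2 * Real.pi)))
    (hsign : ∀ k₁ ∈ S, ∀ k₂ ∈ S, 0 < k₁ 0 * k₂ 0) :
    eLpNorm (zkEvolution s (S.indicator G)) 4 volume ≤
      ENNReal.ofReal (2 ^ (n + 1) * r ^ (n / 4 + s) * ‖G‖) := by
  have hr' : 0 < r / (2 * Real.pi) := by positivity
  have hmem : MemLp (S.indicator G) 2 volume := (Lp.memLp G).indicator hS
  have h := lintegral_enorm_zkEvolution_pow_four_le hs hs' hr'
    ((Lp.stronglyMeasurable G).measurable.indicator hS) hmem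
    (Set.support_indicator_subset.trans hSq)
    (fun k₁ k₂ h1 h2 => hsign _ (Set.mem_of_indicator_ne_zero h1) _
      (Set.mem_of_indicator_ne_zero h2))
  have hG : ∫⁻ k, ‖S.indicator G k‖ₑ ^ 2 ≤ ENNReal.ofReal ‖G‖ ^ 2 := by
    have e := eLpNorm_nnreal_pow_eq_lintegral (f := S.indicator G) (p := 2) (μ := volume)
      (by norm_num)
    have e' : eLpNorm (S.indicator G) 2 volume ^ 2 = ∫⁻ k, ‖S.indicator G k‖ₑ ^ 2 := by
      simpa using e
    rw [← e', ofReal_norm, Lp.enorm_def]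
    gcongr
    exact eLpNorm_indicator_le _
  have e4 : eLpNorm (zkEvolution s (S.indicator G)) 4 volume ^ 4 =
      ∫⁻ w, ‖zkEvolution s (S.indicator G) w‖ₑ ^ 4 := by
    have e := eLpNorm_nnreal_pow_eq_lintegral (f := zkEvolution s (S.indicator G)) (p := 4)
      (μ := volume) (by norm_num)
    simpa using e
  refine (ENNReal.pow_le_pow_left_iff (n := 4) (by norm_num)).1 ?_
  rw [e4]
  refine h.trans ((mul_le_mul_right (pow_le_pow_left₀ bot_le hG 2) _).trans ?_)
  rw [← pow_mul, ← ENNReal.ofReal_pow (norm_nonneg _), ← ENNReal.ofReal_mul (by positivity),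
    ← ENNReal.ofReal_pow (by positivity), mul_pow]
  refine ENNReal.ofReal_le_ofReal ?_
  have hpi : 1 ≤ 2 * Real.pi := by linarith [Real.pi_gt_three]
  have h1 : (r / (2 * Real.pi)) ^ (n + 4 * s) * (2 * Real.pi) ^ (4 * s) ≤
      (r ^ (n / 4 + s)) ^ 4 := by
    rw [← Real.rpow_mul_natCast hr.le, Real.div_rpow hr.le (by positivity),
      show ((n : ℝ) / 4 + s) * (4 : ℕ) = n + 4 * s by push_cast; ring, div_mul_eq_mul_div]
    refine div_le_of_le_mul₀ (by positivity) (by positivity) ?_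
    gcongr ?_ * ?_
    exact Real.rpow_le_rpow_of_exponent_le hpi (by linarith [Nat.cast_nonneg (α := ℝ) n])
  -- A crude bound that avoids a fourth root in the constant.
  have h2 : (2 : ℝ) ^ (n + 1) ≤ (2 ^ (n + 1)) ^ 4 :=
    le_self_pow₀ (one_le_pow₀ one_le_two) (by norm_num)
  rw [mul_assoc (2 ^ (n + 1)), mul_pow]
  gcongr

end Evolution

/-! ### Splitting by the sign of the first frequency -/

theorem proposition2p1 (d : ℕ) [NeZero d] (hd : 3 ≤ d) :
    ∃ C : ℝ, 0 < C ∧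
      ∀ (s : ℝ) (hs : 0 ≤ s), s ≤ 1 / 4 →
        ∀ (p : ZK.Space d) (r : ℝ), 0 < r → ∀ f : ZK.L2 d,
          -- `u` is the function `(t, x, 𝐲) ↦ (|∂ₓ|^s U(t) P_{B_r(p)} f)(x, 𝐲)` on space-time
          ∃ u : ℝ × ZK.Space d → ℂ,
            AEStronglyMeasurable u volume ∧
            (∀ t : ℝ, (fun z => u (t, z)) =ᵐ[volume]
              (ZK.absDx s (ZK.propagator t (ZK.freqProj p r f))
                (ZK.inMultiplierDomain_absDx hs t p r f) : ZK.Space d → ℂ)) ∧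
            eLpNorm u 4 volume ≤
              ENNReal.ofReal (C * r ^ (((d : ℝ) - 3) / 4 + s) * ‖ZK.freqProj p r f‖) := by
  obtain ⟨n, rfl⟩ := Nat.exists_eq_add_of_le' hd
  -- Each of the two sign halves contributes 2^{n+1}.
  refine ⟨2 ^ (n + 2), by positivity, fun s hs hs' p r hr f => ?_⟩
  set q : ZK.Space (n + 3) := (2 * Real.pi)⁻¹ • p with hq
  set G : ZK.L2 (n + 3) := 𝓕 (ZK.freqProj p r f) with hG
  have hball : ∀ k : ZK.Space (n + 3),
      (2 * Real.pi) • k ∈ Metric.ball p r ↔ k ∈ Metric.ball q (r / (2 * Real.pi)) := fun k => by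
    have h2 : (0 : ℝ) < 2 * Real.pi := by positivity
    have : (2 * Real.pi) • k - p = (2 * Real.pi) • (k - q) := by
      rw [hq, smul_sub, smul_inv_smul₀ h2.ne']
    rw [mem_ball_iff_norm, mem_ball_iff_norm, this, norm_smul, Real.norm_of_nonneg h2.le,
      lt_div_iff₀' h2]
  set P : Set (ZK.Space (n + 3)) := Metric.ball q (r / (2 * Real.pi)) ∩ {k | 0 < k 0}
  set N : Set (ZK.Space (n + 3)) := Metric.ball q (r / (2 * Real.pi)) ∩ {k | k 0 < 0}
  have hP : MeasurableSet P :=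
    measurableSet_ball.inter (measurableSet_lt measurable_const (by fun_prop))
  have hN : MeasurableSet N :=
    measurableSet_ball.inter (measurableSet_lt (by fun_prop) measurable_const)
  have hPq : P ⊆ Metric.ball q (r / (2 * Real.pi)) := Set.inter_subset_left
  have hNq : N ⊆ Metric.ball q (r / (2 * Real.pi)) := Set.inter_subset_left
  have hPs : ∀ k₁ ∈ P, ∀ k₂ ∈ P, 0 < k₁ 0 * k₂ 0 := fun k₁ h1 k₂ h2 =>
    mul_pos (show 0 < k₁ 0 from h1.2) (show 0 < k₂ 0 from h2.2)
  have hNs : ∀ k₁ ∈ N, ∀ k₂ ∈ N, 0 < k₁ 0 * k₂ 0 := fun k₁ h1 k₂ h2 =>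
    mul_pos_of_neg_of_neg (show k₁ 0 < 0 from h1.2) (show k₂ 0 < 0 from h2.2)
  have hPm : MemLp (P.indicator G) 2 volume := (Lp.memLp G).indicator hP
  have hNm : MemLp (N.indicator G) 2 volume := (Lp.memLp G).indicator hN
  have hPi := integrable_weight_mul hs hPm (Set.support_indicator_subset.trans hPq)
  have hNi := integrable_weight_mul hs hNm (Set.support_indicator_subset.trans hNq)
  have hPc := (continuous_zkEvolution hPi).aestronglyMeasurable (μ := volume)
  have hNc := (continuous_zkEvolution hNi).aestronglyMeasurable (μ := volume)
  -- The hyperplane k₀ = 0 is null and `G` vanishes a.e. off the ball, so the two halves recover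
  -- `G`.
  have hGae : (G : ZK.Space (n + 3) → ℂ) =ᵐ[volume] P.indicator G + N.indicator G := by
    have h0 : ∀ᵐ k : ZK.Space (n + 3), k 0 ≠ 0 := by
      rw [ae_iff]
      simpa using volume_setOf_apply_zero_eq_zero (d := n + 3)
    filter_upwards [h0, ZK.fourier_fourierMultiplier (ZK.ballSymbol p r) f
      (ZK.inMultiplierDomain_of_bounded (ZK.measurable_ballSymbol p r)
        (ZK.norm_ballSymbol_le p r) f)] with k hk0 hk
    by_cases hkb : k ∈ Metric.ball q (r / (2 * Real.pi))
    · rcases lt_or_gt_of_ne hk0 with h | h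
      · simp [P, N, Set.indicator, hkb, h, not_lt.2 h.le]
      · simp [P, N, Set.indicator, hkb, h, not_lt.2 h.le]
    · have hz : G k = 0 := by
        rw [hG, ZK.freqProj, hk, ZK.ballSymbol, Set.indicator_of_notMem (mt (hball k).1 hkb),
          zero_mul]
      simp [P, N, Set.indicator, hz]
  -- The explicit integral serves as `u`: it is jointly continuous in (t, z), whereas L²
  -- representatives chosen separately for each t need not be jointly measurable.
  have hnorm : ‖G‖ = ‖ZK.freqProj p r f‖ := Lp.norm_fourier_eq _
  refine ⟨zkEvolution s (P.indicator G + N.indicator G), ?_, fun t => ?_, ?_⟩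
  · rw [zkEvolution_add hPi hNi]
    exact hPc.add hNc
  · refine absDx_propagator_ae_eq hs t p r f (hPm.add hNm) (q := q) (r' := r / (2 * Real.pi))
      ?_ hGae
    exact (Function.support_add _ _).trans (Set.union_subset
      (Set.support_indicator_subset.trans hPq) (Set.support_indicator_subset.trans hNq))
  · rw [zkEvolution_add hPi hNi]
    refine (eLpNorm_add_le hPc hNc (by norm_num)).trans ((add_le_add
      (eLpNorm_zkEvolution_le hs hs' hr G hP hPq hPs)
      (eLpNorm_zkEvolution_le hs hs' hr G hN hNq hNs)).trans_eq ?_)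
    have h0 : 0 ≤ (2 : ℝ) ^ (n + 1) * r ^ ((n : ℝ) / 4 + s) * ‖ZK.freqProj p r f‖ :=
      mul_nonneg (mul_nonneg (by positivity) (Real.rpow_nonneg hr.le _)) (norm_nonneg _)
    rw [hnorm, ← ENNReal.ofReal_add h0 h0]
    congr 1
    push_cast
    rw [add_sub_cancel_right]
    ring
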